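/- Let $G$ be a connected simple graph of order $n\ge 4$ with clique number $\omega$, and let $K_\omega$ be a complete subgraph of $G$ on $\omega$ vertices. Let $H=G\setminus K_\omega$ be the graph obtained from $G$ by deleting the edges of $K_\omega$ (and keeping all $n$ vertices). Suppose that $H$ has exactly $r$ non-trivial connected components (components with at least two vertices), and exactly $p\ge 0$ trivial components (isolated vertices), and that there is an integer $c\ge 0$ such that every non-trivial component of $H$ is $c$-cyclic, i.e. a component with $n_i$ vertices has exactly $n_i+c-1$ edges. For $1\le k\le n$ let $S_k(G)=\mu_1+\dots+\mu_k$, where $\mu_1\ge\mu_2\ge\dots\ge\mu_n=0$ are the eigenvalues, with multiplicity, of the Laplacian matrix $L(G)=D(G)-A(G)$ of $G$. Then, for every $1\le k\le n$, $$S_k(G)\le\begin{cases}\omega(\omega-1)+n-p+2r(c-1)+2k, & \text{if } k\ge\omega-1,\\[2pt] k(\omega+2)+n-p+2r(c-1), & \text{if } k\le\omega-2.\end{cases}$$ -/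

import Mathlib

/-- `laplacianSum G k` is `S_k(G)`, the sum of the `k` largest eigenvalues `μ₁ ≥ ⋯ ≥ μ_k`
(with multiplicity) of the Laplacian matrix `L(G) = D(G) - A(G)`; Mathlib's `eigenvalues₀` lists
the eigenvalues in non-increasing order. -/
noncomputable def laplacianSum {V : Type*} [Fintype V] [DecidableEq V] (G : SimpleGraph V)
    [DecidableRel G.Adj] (k : ℕ) : ℝ :=
  ∑ i : Fin (Fintype.card V) with i.val < k, (G.isHermitian_lapMatrix ℝ).eigenvalues₀ i

/-- The spanning subgraph of `G` obtained by removing all edges with both ends in `s`, keeping all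
the vertices. If `s` is a clique, these are the edges of the complete subgraph on `s`. -/
def removeEdgesWithin {V : Type*} (G : SimpleGraph V) (s : Finset V) : SimpleGraph V :=
  G.deleteEdges {e | ∀ v ∈ e, v ∈ s}

/-- A finite graph with `n` vertices is `c`-cyclic if it has `n + c - 1` edges. (This is used only
for connected components, which are automatically connected graphs.) -/
def IsCCyclic {W : Type*} (G : SimpleGraph W) (c : ℕ) : Prop :=
  G.edgeSet.ncard + 1 = Nat.card W + c

/-- A connected component is non-trivial if it has at least two vertices, and trivial if it
consists of a single vertex. -/
def IsNontrivialComponent {V : Type*} {H : SimpleGraph V} (C : H.ConnectedComponent) : Prop :=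
  C.supp.Nontrivial

/-! Deleting the clique splits the Laplacian form of `G` into that of `H` and that of the clique. If
A ≤ aI + B as quadratic forms with B positive semidefinite, the k largest eigenvalues of A sum to at
most ka + tr B (`sum_eigenvalues_le_of_quadraticForm_le`). The core is `hasLaplacianCertificate`:
L(H) ≤ 2I + B with tr B at most the sum of deg v - 1 over non-isolated v. A component with n_i
vertices and n_i + c - 1 edges contributes n_i + 2(c - 1) to that sum, so the total is n - p + 2r(c
- 1). The clique Laplacian has trace ω(ω - 1) and is at most ωI. It costs ω(ω - 1) if absorbed in B
and kω if absorbed in the scalar; the former is no dearer once k ≥ ω - 1. -/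

open Finset Matrix

/-! ### Eigenvalue sums from quadratic form bounds -/

/-- The trace of a real matrix is the sum of the values of its quadratic form on an orthonormal
basis. -/
theorem trace_eq_sum_quadraticForm {V ι : Type*} [Fintype V] [DecidableEq V] [Fintype ι]
    (B : Matrix V V ℝ) (b : OrthonormalBasis ι ℝ (EuclideanSpace ℝ V)) :
    B.trace = ∑ i, (b i).ofLp ⬝ᵥ (B *ᵥ (b i).ofLp) := by
  classical
  have h1 := LinearMap.trace_eq_sum_inner (Matrix.toEuclideanLin B) b
  have h2 := LinearMap.trace_eq_sum_inner (Matrix.toEuclideanLin B) (EuclideanSpace.basisFun V ℝ)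
  have h3 : B.trace = ∑ i, inner ℝ ((EuclideanSpace.basisFun V ℝ) i)
      (Matrix.toEuclideanLin B ((EuclideanSpace.basisFun V ℝ) i)) := by
    simp [Matrix.trace, PiLp.inner_apply]
  rw [h3, ← h2, h1]
  refine Finset.sum_congr rfl fun i _ => ?_
  simp [PiLp.inner_apply, dotProduct, mul_comm]

/-- If `xᵀAx ≤ a‖x‖² + xᵀBx` for all `x`, where `B` is positive semidefinite, then the sum of the `k`
largest eigenvalues of `A` is at most `k * a + tr B`. -/
theorem sum_eigenvalues_le_of_quadraticForm_le {V : Type*} [Fintype V] [DecidableEq V]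
    {A B : Matrix V V ℝ} (hA : A.IsHermitian) (hB : B.PosSemidef) {a : ℝ}
    (h : ∀ x : V → ℝ, x ⬝ᵥ (A *ᵥ x) ≤ a * (x ⬝ᵥ x) + x ⬝ᵥ (B *ᵥ x))
    {k : ℕ} (hk : k ≤ Fintype.card V) :
    ∑ i : Fin (Fintype.card V) with i.val < k, hA.eigenvalues₀ i ≤ k * a + B.trace := by
  -- The eigenbasis is reindexed by `Fin` so that its order matches `eigenvalues₀`.
  let e := (Fintype.equivOfCardEq (Fintype.card_fin _) : Fin (Fintype.card V) ≃ V)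
  let b := hA.eigenvectorBasis.reindex e.symm
  have hb1 (i) : (b i).ofLp ⬝ᵥ (b i).ofLp = 1 := by
    have := b.orthonormal.1 i
    have h2 : inner ℝ (b i) (b i) = (1 : ℝ) := by
      rw [real_inner_self_eq_norm_sq, this]; norm_num
    rw [← h2, PiLp.inner_apply]
    rfl
  have hb2 (i) : (b i).ofLp ⬝ᵥ (A *ᵥ (b i).ofLp) = hA.eigenvalues₀ i := by
    have h2 : A *ᵥ (b i).ofLp = hA.eigenvalues₀ i • (b i).ofLp := by
      have := hA.mulVec_eigenvectorBasis (e i)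
      simpa [b, IsHermitian.eigenvalues, e] using this
    rw [h2, dotProduct_smul, hb1]; simp
  have hcard : (Finset.univ.filter fun i : Fin (Fintype.card V) => i.val < k).card = k := by
    rw [Fin.card_filter_val_lt]; exact min_eq_right hk
  calc ∑ i : Fin (Fintype.card V) with i.val < k, hA.eigenvalues₀ i
      ≤ ∑ i : Fin (Fintype.card V) with i.val < k,
          (a + (b i).ofLp ⬝ᵥ (B *ᵥ (b i).ofLp)) := by
        refine Finset.sum_le_sum fun i _ => ?_
        have := h (b i).ofLp
        rwa [hb1, hb2, mul_one] at this
    _ = k * a + ∑ i : Fin (Fintype.card V) with i.val < k,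
          (b i).ofLp ⬝ᵥ (B *ᵥ (b i).ofLp) := by
        rw [Finset.sum_add_distrib, Finset.sum_const, hcard, nsmul_eq_mul]
    -- Positivity of `B` lets the sum grow to the whole basis, where it is the trace.
    _ ≤ k * a + ∑ i, (b i).ofLp ⬝ᵥ (B *ᵥ (b i).ofLp) := by
        gcongr
        · intro i _ _
          simpa using hB.dotProduct_mulVec_nonneg (b i).ofLp
        · exact Finset.filter_subset _ _
    _ = k * a + B.trace := by rw [← trace_eq_sum_quadraticForm]

namespace SimpleGraph

variable {V : Type*} [Fintype V] [DecidableEq V]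

/-! ### Laplacian forms and degrees under edge removal -/

theorem dotProduct_lapMatrix_mulVec (G : SimpleGraph V) [DecidableRel G.Adj] (x : V → ℝ) :
    x ⬝ᵥ (G.lapMatrix ℝ *ᵥ x) =
      (∑ i, ∑ j, if G.Adj i j then (x i - x j) ^ 2 else 0) / 2 := by
  rw [← lapMatrix_toLinearMap₂' ℝ G x, toLinearMap₂'_apply']

theorem trace_lapMatrix (G : SimpleGraph V) [DecidableRel G.Adj] :
    (G.lapMatrix ℝ).trace = ∑ v, (G.degree v : ℝ) := by
  simp [Matrix.trace, lapMatrix, degMatrix]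

omit [DecidableEq V] in
theorem degree_eq_zero_iff_forall_not_adj (G : SimpleGraph V) [DecidableRel G.Adj] (v : V) :
    G.degree v = 0 ↔ ∀ w, ¬ G.Adj v w := by
  rw [← not_exists, ← G.degree_pos_iff_exists_adj v, not_lt, Nat.le_zero]

theorem degree_eq_degree_add_degree_sdiff {G H : SimpleGraph V} [DecidableRel G.Adj]
    [DecidableRel H.Adj] [DecidableRel (G \ H).Adj] (h : H ≤ G) (v : V) :
    G.degree v = H.degree v + (G \ H).degree v := by
  simp only [← card_neighborFinset_eq_degree]
  rw [← Finset.card_union_of_disjoint]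
  · congr 1
    ext w
    have := @h v w
    simp only [mem_neighborFinset, Finset.mem_union, sdiff_adj]
    tauto
  · rw [Finset.disjoint_left]
    intro w
    simp only [mem_neighborFinset, sdiff_adj]
    tauto

theorem dotProduct_lapMatrix_mulVec_eq_add_sdiff {G H : SimpleGraph V} [DecidableRel G.Adj]
    [DecidableRel H.Adj] [DecidableRel (G \ H).Adj] (h : H ≤ G) (x : V → ℝ) :
    x ⬝ᵥ (G.lapMatrix ℝ *ᵥ x) =
      x ⬝ᵥ (H.lapMatrix ℝ *ᵥ x) + x ⬝ᵥ ((G \ H).lapMatrix ℝ *ᵥ x) := by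
  simp only [dotProduct_lapMatrix_mulVec]
  rw [← add_div, ← Finset.sum_add_distrib]
  congr 1
  refine Finset.sum_congr rfl fun i _ => ?_
  rw [← Finset.sum_add_distrib]
  refine Finset.sum_congr rfl fun j _ => ?_
  have := @h i j
  by_cases h1 : G.Adj i j <;> by_cases h2 : H.Adj i j <;> simp_all [sdiff_adj]

/-! ### Stars -/

/-- The quadratic form of the Laplacian of a star with centre `v` and leaves `N`. -/
theorem dotProduct_lapMatrix_mulVec_of_star (S : SimpleGraph V) [DecidableRel S.Adj] {v : V}
    (hS : ∀ i j, S.Adj i j → i = v ∨ j = v) (x : V → ℝ) :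
    x ⬝ᵥ (S.lapMatrix ℝ *ᵥ x) = ∑ w ∈ S.neighborFinset v, (x v - x w) ^ 2 := by
  rw [dotProduct_lapMatrix_mulVec]
  have key : ∀ i j, (if S.Adj i j then (x i - x j) ^ 2 else 0) =
      (if i = v then (if S.Adj v j then (x v - x j) ^ 2 else 0) else 0) +
      (if j = v then (if S.Adj v i then (x v - x i) ^ 2 else 0) else 0) := by
    intro i j
    by_cases hi : i = v
    · subst hi
      by_cases hj : j = i
      · subst hj; simp
      · simp [hj]
    · by_cases hj : j = v
      · subst hj
        rw [if_congr (S.adj_comm i j) rfl rfl]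
        simp only [hi, if_false, zero_add, if_true]
        split_ifs <;> ring
      · have : ¬ S.Adj i j := fun h => (hS i j h).elim hi hj
        simp [hi, hj, this]
  rw [Finset.sum_congr rfl fun i _ => Finset.sum_congr rfl fun j _ => key i j]
  simp_rw [Finset.sum_add_distrib]
  rw [Finset.sum_comm]
  simp only [Finset.sum_ite_eq', Finset.mem_univ, if_true]
  rw [← Finset.sum_filter, ← S.neighborFinset_eq_filter]
  ring

/-- Here `a` is the value at the centre, `s` and `Q` the sum and the sum of squares over the `m`
leaves. The star has eigenvalues 0, 1, m + 1; only the last can exceed 2, by m - 1. The slack is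
twice the squared projection onto the constants plus that onto the eigenvalue 1 space. -/
theorem star_quadratic_inequality {m a s Q : ℝ} (hm : 1 ≤ m) (h : s ^ 2 ≤ m * Q) :
    m * a ^ 2 - 2 * a * s + Q ≤
      2 * (a ^ 2 + Q) + (m - 1) / (m * (m + 1)) * (m * a - s) ^ 2 := by
  have hm0 : 0 < m := by linarith
  have hQ : 0 ≤ Q - s ^ 2 / m := by
    rw [sub_nonneg, div_le_iff₀ hm0]; linarith
  have h2 : 0 ≤ 2 / (m + 1) * (a + s) ^ 2 := by positivity
  have : 2 * (a ^ 2 + Q) + (m - 1) / (m * (m + 1)) * (m * a - s) ^ 2 -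
      (m * a ^ 2 - 2 * a * s + Q) = 2 / (m + 1) * (a + s) ^ 2 + (Q - s ^ 2 / m) := by
    field_simp
    ring
  linarith

/-- The Laplacian of a nontrivial star is bounded by twice the identity on its vertices plus a
positive semidefinite matrix whose trace is the number of leaves minus one. -/
theorem exists_posSemidef_of_star (N : Finset V) {v : V} (hv : v ∉ N) (hN : N.Nonempty) :
    ∃ B : Matrix V V ℝ, B.PosSemidef ∧ B.trace = N.card - 1 ∧
      ∀ x : V → ℝ, ∑ w ∈ N, (x v - x w) ^ 2 ≤
        2 * (x v ^ 2 + ∑ w ∈ N, x w ^ 2) + x ⬝ᵥ (B *ᵥ x) := by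
  set m : ℝ := ((N.card : ℕ) : ℝ) with hm_def
  have hm : 1 ≤ m := by exact_mod_cast Nat.one_le_cast.2 hN.card_pos
  -- The eigenvector of the star for m + 1; its squared norm is m(m + 1).
  let a : V → ℝ := fun w => (if w = v then m else 0) + (if w ∈ N then -1 else 0)
  have hax (x : V → ℝ) : a ⬝ᵥ x = m * x v - ∑ w ∈ N, x w := by
    simp [a, dotProduct, add_mul, ite_mul, Finset.sum_add_distrib, Finset.sum_ite_mem, sub_eq_add_neg]
  have haa : a ⬝ᵥ a = m * (m + 1) := by
    rw [hax]
    have h1 : a v = m := by simp [a, hv]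
    have h2 : ∑ w ∈ N, a w = ∑ w ∈ N, (-1 : ℝ) := by
      refine Finset.sum_congr rfl fun w hw => ?_
      have : w ≠ v := fun h => hv (h ▸ hw)
      simp [a, hw, this]
    rw [h1, h2, Finset.sum_const, nsmul_eq_mul, ← hm_def]
    ring
  have hc : 0 ≤ (m - 1) / (m * (m + 1)) := by
    apply div_nonneg <;> nlinarith
  refine ⟨((m - 1) / (m * (m + 1))) • vecMulVec a a, ?_, ?_, fun x => ?_⟩
  · have := posSemidef_vecMulVec_self_star a
    rw [star_trivial] at this
    exact this.smul hc
  · rw [trace_smul, trace_vecMulVec, haa, smul_eq_mul]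
    field_simp
  · have h1 : x ⬝ᵥ ((((m - 1) / (m * (m + 1))) • vecMulVec a a) *ᵥ x) =
        (m - 1) / (m * (m + 1)) * (m * x v - ∑ w ∈ N, x w) ^ 2 := by
      rw [smul_mulVec, dotProduct_smul, vecMulVec_mulVec, ← hax, smul_eq_mul]
      simp only [op_smul_eq_smul, dotProduct_smul, smul_eq_mul, dotProduct_comm x a]
      ring
    have h2 : ∑ w ∈ N, (x v - x w) ^ 2 =
        m * x v ^ 2 - 2 * x v * ∑ w ∈ N, x w + ∑ w ∈ N, x w ^ 2 := by
      simp_rw [sub_sq, Finset.sum_add_distrib, Finset.sum_sub_distrib, Finset.sum_const,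
        nsmul_eq_mul, ← Finset.mul_sum, ← hm_def]
    rw [h1, h2]
    exact star_quadratic_inequality hm sq_sum_le_card_mul_sum_sq

/-! ### Certificates by induction on the graph -/

/-- `H.HasLaplacianCertificate` says that the Laplacian of `H` is bounded by twice the identity on
the non-isolated vertices plus a positive semidefinite matrix of trace at most
`∑ (deg v - 1)`, the sum being over the non-isolated vertices. -/
def HasLaplacianCertificate (H : SimpleGraph V) [DecidableRel H.Adj] : Prop :=
  ∃ B : Matrix V V ℝ, B.PosSemidef ∧ B.trace ≤ ∑ v, ((H.degree v - 1 : ℕ) : ℝ) ∧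
    ∀ x : V → ℝ, x ⬝ᵥ (H.lapMatrix ℝ *ᵥ x) ≤
      2 * (∑ v, if 0 < H.degree v then x v ^ 2 else 0) + x ⬝ᵥ (B *ᵥ x)

/-- The edge Laplacian, of trace 2, is added to B. Each end pays one unit of deg - 1 and stays
non-isolated. -/
theorem HasLaplacianCertificate.of_sdiff_edge {H : SimpleGraph V} [DecidableRel H.Adj] {u v : V}
    [DecidableRel (edge u v).Adj] [DecidableRel (H \ edge u v).Adj]
    (huv : H.Adj u v) (hu : 2 ≤ H.degree u) (hv : 2 ≤ H.degree v)
    (h : (H \ edge u v).HasLaplacianCertificate) : H.HasLaplacianCertificate := by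
  have hle : edge u v ≤ H := (edge_le_iff H).2 (Or.inr huv)
  have hdeg : ∀ w, (edge u v).degree w ≤ 1 := fun w => by
    rw [← card_neighborFinset_eq_degree, Finset.card_le_one]
    intro a ha b hb
    simp only [mem_neighborFinset, edge_adj] at ha hb
    grind
  have hdeg' : ∀ w, 0 < (edge u v).degree w → 2 ≤ H.degree w := fun w hw => by
    obtain ⟨a, ha⟩ := ((edge u v).degree_pos_iff_exists_adj w).1 hw
    rw [edge_adj] at ha
    rcases ha.1 with ⟨rfl, _⟩ | ⟨rfl, _⟩ <;> assumption
  have hsplit := degree_eq_degree_add_degree_sdiff hle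
  obtain ⟨B, hB, htr, hx⟩ := h
  refine ⟨B + (edge u v).lapMatrix ℝ, hB.add (posSemidef_lapMatrix ℝ _), ?_, fun x => ?_⟩
  · rw [trace_add, trace_lapMatrix]
    refine (add_le_add_left htr _).trans ?_
    rw [← Finset.sum_add_distrib]
    refine Finset.sum_le_sum fun w _ => ?_
    have h1 := hdeg w
    have h2 := hdeg' w
    have h3 := hsplit w
    exact_mod_cast (by omega : ((H \ edge u v).degree w - 1) + (edge u v).degree w ≤ H.degree w - 1)
  · rw [dotProduct_lapMatrix_mulVec_eq_add_sdiff hle, add_mulVec, dotProduct_add]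
    have h4 : (∑ v, if 0 < H.degree v then x v ^ 2 else 0) =
        ∑ w, if 0 < (H \ edge u v).degree w then x w ^ 2 else 0 := by
      refine Finset.sum_congr rfl fun w _ => ?_
      have h1 := hdeg w
      have h2 := hdeg' w
      have h3 := hsplit w
      congr 1
      exact propext ⟨fun _ => by omega, fun _ => by omega⟩
    rw [h4]
    linarith [hx x]

/-- The star at `v` is a whole component and becomes isolated in `H \ S`, so the 2I terms of star
and remainder have disjoint supports: hence the restriction to non-isolated vertices. In the trace
budget leaves count 0 and the centre deg v - 1. -/
theorem HasLaplacianCertificate.of_star {H S : SimpleGraph V} [DecidableRel H.Adj]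
    [DecidableRel S.Adj] [DecidableRel (H \ S).Adj] {v : V}
    (hS : ∀ i j, S.Adj i j ↔ H.Adj i j ∧ (i = v ∨ j = v))
    (hv : 0 < H.degree v) (hN : ∀ w, H.Adj v w → H.degree w = 1)
    (h : (H \ S).HasLaplacianCertificate) : H.HasLaplacianCertificate := by
  have hle : S ≤ H := fun i j hij => ((hS i j).1 hij).1
  have hnb : S.neighborFinset v = H.neighborFinset v := by
    ext w; simp [hS]
  have hdv : (H \ S).degree v = 0 := by
    rw [degree_eq_zero_iff_forall_not_adj]
    intro w
    simp only [sdiff_adj, hS]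
    tauto
  have hdN : ∀ w, H.Adj v w → (H \ S).degree w = 0 := by
    intro w hw
    have h1 := degree_eq_degree_add_degree_sdiff hle w
    have h2 : 0 < S.degree w :=
      (S.degree_pos_iff_exists_adj w).2 ⟨v, (hS _ _).2 ⟨hw.symm, Or.inr rfl⟩⟩
    have h3 := hN w hw
    omega
  have hdo : ∀ w, w ≠ v → ¬ H.Adj v w → (H \ S).degree w = H.degree w := by
    intro w hw hw'
    have h1 := degree_eq_degree_add_degree_sdiff hle w
    have h2 : S.degree w = 0 := by
      rw [degree_eq_zero_iff_forall_not_adj]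
      rintro a ha
      obtain ⟨ha, rfl | rfl⟩ := (hS _ _).1 ha
      · exact hw rfl
      · exact hw' ha.symm
    omega
  have hne : (H.neighborFinset v).Nonempty := by
    rwa [← Finset.card_pos, card_neighborFinset_eq_degree]
  obtain ⟨B, hB, htr, hx⟩ := h
  obtain ⟨B', hB', htr', hx'⟩ := exists_posSemidef_of_star (H.neighborFinset v) (v := v)
    (by simp) hne
  refine ⟨B + B', hB.add hB', ?_, fun x => ?_⟩
  · rw [trace_add, htr', card_neighborFinset_eq_degree]
    have h1 : ∀ w, ((H.degree w - 1 : ℕ) : ℝ) = (((H \ S).degree w - 1 : ℕ) : ℝ) +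
        if w = v then (H.degree v : ℝ) - 1 else 0 := by
      intro w
      by_cases hw : w = v
      · subst hw
        rw [hdv, Nat.cast_sub hv]
        simp
      · by_cases hw' : H.Adj v w
        · simp [hw, hdN w hw', hN w hw']
        · simp [hw, hdo w hw hw']
    simp_rw [h1, Finset.sum_add_distrib]
    simpa using htr
  · rw [dotProduct_lapMatrix_mulVec_eq_add_sdiff hle, add_mulVec, dotProduct_add,
      dotProduct_lapMatrix_mulVec_of_star S (fun i j hij => ((hS i j).1 hij).2), hnb]
    have h1 : ∀ w, (if 0 < H.degree w then x w ^ 2 else 0) =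
        (if 0 < (H \ S).degree w then x w ^ 2 else 0) + ((if w = v then x w ^ 2 else 0) +
          if w ∈ H.neighborFinset v then x w ^ 2 else 0) := by
      intro w
      by_cases hw : w = v
      · subst hw
        simp [hdv, hv]
      · by_cases hw' : H.Adj v w
        · simp [hw, hdN w hw', hN w hw', hw']
        · simp [hw, hdo w hw hw', hw']
    simp_rw [h1, Finset.sum_add_distrib]
    have h2 := hx x
    have h3 := hx' x
    simp only [Finset.sum_ite_eq', Finset.mem_univ, if_true, Finset.sum_ite_mem,
      Finset.univ_inter]
    linarith

/-- Once no edge joins two vertices of degree at least 2, every edge has a leaf end, so the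
non-trivial components are stars and can be removed whole. -/
theorem hasLaplacianCertificate (H : SimpleGraph V) [i : DecidableRel H.Adj] :
    H.HasLaplacianCertificate := by
  classical
  revert i
  induction H using WellFoundedLT.induction with
  | ind H ih =>
  intro _
  by_cases h2 : ∃ u v, H.Adj u v ∧ 2 ≤ H.degree u ∧ 2 ≤ H.degree v
  · obtain ⟨u, v, huv, hu, hv⟩ := h2
    refine .of_sdiff_edge huv hu hv (ih _ (lt_of_le_of_ne sdiff_le fun h => ?_))
    rw [← h] at huv
    exact huv.2 ((edge_adj ..).2 ⟨Or.inl ⟨rfl, rfl⟩, huv.1.ne⟩)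
  push Not at h2
  by_cases h1 : ∃ u v, H.Adj u v ∧ H.degree u = 1
  · obtain ⟨u, v, huv, hu⟩ := h1
    let S : SimpleGraph V :=
      { Adj := fun i j => H.Adj i j ∧ (i = v ∨ j = v)
        symm := ⟨fun i j h => ⟨h.1.symm, h.2.symm⟩⟩
        loopless := ⟨fun i h => H.irrefl h.1⟩ }
    have hv : 0 < H.degree v := (H.degree_pos_iff_exists_adj v).2 ⟨u, huv.symm⟩
    refine .of_star (S := S) (v := v) (fun i j => Iff.rfl) hv (fun w hw => ?_)
      (ih _ (lt_of_le_of_ne sdiff_le fun h => ?_))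
    · have hw0 : 0 < H.degree w := (H.degree_pos_iff_exists_adj w).2 ⟨v, hw.symm⟩
      -- If `v` has degree 1, its only neighbour is the leaf `u`.
      by_cases hv2 : 2 ≤ H.degree v
      · have := h2 v w hw hv2
        omega
      · have hv1 : (H.neighborFinset v).card ≤ 1 := by
          rw [card_neighborFinset_eq_degree]; omega
        have := Finset.card_le_one.1 hv1 w (by simpa using hw) u (by simpa using huv.symm)
        rw [this, hu]
    · have h3 : (H \ S).Adj u v := by rw [h]; exact huv
      exact h3.2 ⟨huv, Or.inr rfl⟩
  · push Not at h1
    have h0 : ∀ u v, ¬ H.Adj u v := by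
      intro u v huv
      have hu : 0 < H.degree u := (H.degree_pos_iff_exists_adj u).2 ⟨v, huv⟩
      have hv : 0 < H.degree v := (H.degree_pos_iff_exists_adj v).2 ⟨u, huv.symm⟩
      have := h1 u v huv
      have := h1 v u huv.symm
      have := h2 u v huv (by omega)
      omega
    refine ⟨0, .zero, ?_, fun x => ?_⟩
    · rw [trace_zero]; positivity
    · rw [dotProduct_lapMatrix_mulVec]
      simp only [h0, if_false, Finset.sum_const_zero, zero_div, zero_mulVec, dotProduct_zero,
        add_zero]
      positivity

/-! ### Degree sums over components -/

theorem ConnectedComponent.sum_degree_eq_two_mul_ncard_edgeSet {H : SimpleGraph V}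
    [DecidableRel H.Adj] [DecidableEq H.ConnectedComponent] (C : H.ConnectedComponent) :
    ∑ v with H.connectedComponentMk v = C, H.degree v = 2 * C.toSimpleGraph.edgeSet.ncard := by
  classical
  have h1 : C.toSimpleGraph.edgeSet.ncard = C.toSimpleGraph.edgeFinset.card := by
    rw [← coe_edgeFinset, Set.ncard_coe_finset]
  rw [h1, ← sum_degrees_eq_twice_card_edges]
  refine Finset.sum_bij' (fun v hv => ⟨v, (Finset.mem_filter.1 hv).2⟩) (fun v _ => v.1)
    (fun _ _ => Finset.mem_univ _) (fun v _ => Finset.mem_filter.2 ⟨Finset.mem_univ _, v.2⟩)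
    (fun _ _ => rfl) (fun _ _ => rfl) fun v hv => ?_
  have h2 := degree_induce_of_neighborSet_subset (G := H) (s := C.supp)
    (v := ⟨v, (Finset.mem_filter.1 hv).2⟩) fun w hw =>
      C.mem_supp_of_adj_mem_supp (Finset.mem_filter.1 hv).2 hw
  rw [← h2]
  unfold toSimpleGraph
  congr!

theorem sum_degree_sub_one_of_isCCyclic {H : SimpleGraph V} [DecidableRel H.Adj] {r p c : ℕ}
    (hr : {C : H.ConnectedComponent | IsNontrivialComponent C}.ncard = r)
    (hp : {C : H.ConnectedComponent | ¬ IsNontrivialComponent C}.ncard = p)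
    (hc : ∀ C : H.ConnectedComponent, IsNontrivialComponent C → IsCCyclic C.toSimpleGraph c) :
    ∑ v, ((H.degree v - 1 : ℕ) : ℝ) = Fintype.card V - p + 2 * r * ((c : ℝ) - 1) := by
  classical
  have hcard : ∀ C : H.ConnectedComponent,
      Nat.card C = (univ.filter fun v => H.connectedComponentMk v = C).card := by
    intro C
    rw [← Fintype.card_subtype, ← Nat.card_eq_fintype_card]
    rfl
  -- In a trivial component the truncated 0 - 1 is 0, which equals size 1 plus the correction -1.
  have key : ∀ C : H.ConnectedComponent,
      ∑ v with H.connectedComponentMk v = C, ((H.degree v - 1 : ℕ) : ℝ) =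
        (univ.filter fun v => H.connectedComponentMk v = C).card +
          if IsNontrivialComponent C then 2 * ((c : ℝ) - 1) else -1 := by
    intro C
    split_ifs with hC
    · have h1 : ∀ v ∈ univ.filter fun v => H.connectedComponentMk v = C,
          ((H.degree v - 1 : ℕ) : ℝ) = (H.degree v : ℝ) - 1 := by
        intro v hv
        rw [Finset.mem_filter] at hv
        have hv' : v ∈ C.supp := hv.2
        have : Nontrivial C := Set.nontrivial_coe_sort.2 hC
        obtain ⟨w, hw⟩ := C.connected_toSimpleGraph.preconnected.exists_adj_of_nontrivial ⟨v, hv'⟩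
        rw [Nat.cast_sub, Nat.cast_one]
        exact (H.degree_pos_iff_exists_adj v).2 ⟨w.1, hw⟩
      have h2 := hc C hC
      rw [IsCCyclic, hcard] at h2
      have h3 := C.sum_degree_eq_two_mul_ncard_edgeSet
      have h2' : (C.toSimpleGraph.edgeSet.ncard : ℝ) + 1 =
        (univ.filter fun v => H.connectedComponentMk v = C).card + c := by exact_mod_cast h2
      have h3' : ∑ v with H.connectedComponentMk v = C, (H.degree v : ℝ) =
        2 * C.toSimpleGraph.edgeSet.ncard := by exact_mod_cast h3
      rw [Finset.sum_congr rfl h1, Finset.sum_sub_distrib, h3', Finset.sum_const, nsmul_one]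
      linarith
    · have hsub : C.supp.Subsingleton := Set.not_nontrivial_iff.1 hC
      obtain ⟨v, hv⟩ := C.nonempty_supp
      have h1 : (univ.filter fun v => H.connectedComponentMk v = C) = {v} := by
        ext w
        simp only [Finset.mem_filter, Finset.mem_univ, true_and, Finset.mem_singleton]
        exact ⟨fun hw => hsub hw hv, fun hw => hw ▸ hv⟩
      have h2 : H.degree v = 0 := by
        rw [degree_eq_zero_iff_forall_not_adj]
        intro w hw
        exact hw.ne (hsub hv (C.mem_supp_of_adj_mem_supp hv hw))
      rw [h1]
      simp [h2]
  rw [← Finset.sum_fiberwise univ H.connectedComponentMk]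
  simp_rw [key]
  have hsum : ∑ C : H.ConnectedComponent,
      ((univ.filter fun v => H.connectedComponentMk v = C).card : ℝ) = Fintype.card V := by
    rw [← Nat.cast_sum, ← Finset.card_univ]
    exact congrArg _ (Finset.card_eq_sum_card_fiberwise fun _ _ => Finset.mem_univ _).symm
  rw [Finset.sum_add_distrib, hsum, Finset.sum_ite, Finset.sum_const, Finset.sum_const, ← hr, ← hp,
    Set.ncard_eq_toFinset_card', Set.ncard_eq_toFinset_card', Set.toFinset_ofPred,
    Set.toFinset_ofPred]
  simp only [nsmul_eq_mul]
  ring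

/-! ### The clique -/

/-- The Laplacian form of a graph whose edges are the pairs of distinct elements of `s`. -/
theorem dotProduct_lapMatrix_mulVec_le_of_complete_on {K : SimpleGraph V} [DecidableRel K.Adj]
    {s : Finset V} (hK : ∀ i j, K.Adj i j ↔ i ∈ s ∧ j ∈ s ∧ i ≠ j) (x : V → ℝ) :
    x ⬝ᵥ (K.lapMatrix ℝ *ᵥ x) ≤ s.card * (x ⬝ᵥ x) := by
  have h1 : ∀ i j, (if K.Adj i j then (x i - x j) ^ 2 else 0) =
      if i ∈ s then (if j ∈ s then (x i - x j) ^ 2 else 0) else 0 := by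
    intro i j
    rw [if_congr (hK i j) rfl rfl]
    by_cases hij : i = j
    · subst hij; simp
    · by_cases hi : i ∈ s <;> by_cases hj : j ∈ s <;> simp [hi, hj, hij]
  rw [dotProduct_lapMatrix_mulVec,
    Finset.sum_congr rfl fun i _ => Finset.sum_congr rfl fun j _ => h1 i j]
  have h2 : ∀ i, (∑ j, if i ∈ s then (if j ∈ s then (x i - x j) ^ 2 else 0) else 0) =
      if i ∈ s then ∑ j ∈ s, (x i - x j) ^ 2 else 0 := by
    intro i
    split_ifs <;> simp
  rw [Finset.sum_congr rfl fun i _ => h2 i, Finset.sum_ite_mem, Finset.univ_inter]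
  have h3 : ∑ i ∈ s, ∑ j ∈ s, (x i - x j) ^ 2 =
      2 * (s.card * ∑ i ∈ s, x i ^ 2) - 2 * (∑ i ∈ s, x i) ^ 2 := by
    simp_rw [sub_sq, Finset.sum_add_distrib, Finset.sum_sub_distrib, Finset.sum_const,
      nsmul_eq_mul, ← Finset.mul_sum, ← Finset.sum_mul, ← Finset.mul_sum]
    ring
  have h4 : ∑ i ∈ s, x i ^ 2 ≤ x ⬝ᵥ x := by
    simp_rw [dotProduct, ← sq]
    exact Finset.sum_le_sum_of_subset_of_nonneg (Finset.subset_univ _) fun _ _ _ => sq_nonneg _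
  have h5 : (s.card : ℝ) * ∑ i ∈ s, x i ^ 2 ≤ s.card * (x ⬝ᵥ x) := by gcongr
  rw [h3]
  linarith [sq_nonneg (∑ i ∈ s, x i)]

theorem trace_lapMatrix_of_complete_on {K : SimpleGraph V} [DecidableRel K.Adj]
    {s : Finset V} (hK : ∀ i j, K.Adj i j ↔ i ∈ s ∧ j ∈ s ∧ i ≠ j) :
    (K.lapMatrix ℝ).trace = s.card * (s.card - 1 : ℝ) := by
  rw [trace_lapMatrix]
  have h1 : ∀ v, (K.degree v : ℝ) = if v ∈ s then (s.card : ℝ) - 1 else 0 := by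
    intro v
    split_ifs with hv
    · have : K.neighborFinset v = s.erase v := by
        ext w
        simp only [mem_neighborFinset, hK, Finset.mem_erase]
        grind
      rw [← card_neighborFinset_eq_degree, this, Finset.card_erase_of_mem hv,
        Nat.cast_sub (Finset.card_pos.2 ⟨v, hv⟩), Nat.cast_one]
    · have : K.degree v = 0 := by
        rw [degree_eq_zero_iff_forall_not_adj]
        exact fun w hw => hv ((hK v w).1 hw).1
      simp [this]
  simp [h1, mul_sub]

end SimpleGraph

/-! ### The two bounds -/

theorem mainTheorem4 {V : Type*} [Fintype V] [DecidableEq V] (G : SimpleGraph V)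
    [DecidableRel G.Adj] (hconn : G.Connected) (n ω : ℕ)
    (hn : Fintype.card V = n) (hn4 : 4 ≤ n) (hω : G.cliqueNum = ω)
    (s : Finset V) (hs : G.IsNClique ω s)
    (r p c : ℕ)
    (hr : {C : (removeEdgesWithin G s).ConnectedComponent | IsNontrivialComponent C}.ncard = r)
    (hp : {C : (removeEdgesWithin G s).ConnectedComponent | ¬ IsNontrivialComponent C}.ncard = p)
    (hc : ∀ C : (removeEdgesWithin G s).ConnectedComponent,
      IsNontrivialComponent C → IsCCyclic C.toSimpleGraph c)
    (k : ℕ) (hk1 : 1 ≤ k) (hkn : k ≤ n) :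
    ((ω : ℤ) - 1 ≤ k →
      laplacianSum G k ≤ (ω : ℝ) * (ω - 1) + n - p + 2 * r * ((c : ℝ) - 1) + 2 * k) ∧
    ((k : ℤ) ≤ ω - 2 →
      laplacianSum G k ≤ (k : ℝ) * (ω + 2) + n - p + 2 * r * ((c : ℝ) - 1)) := by
  classical
  set H := removeEdgesWithin G s with hH
  have hle : H ≤ G := G.deleteEdges_le _
  have hK : ∀ i j, (G \ H).Adj i j ↔ i ∈ s ∧ j ∈ s ∧ i ≠ j := by
    intro i j
    have hij : i ∈ s → j ∈ s → i ≠ j → G.Adj i j := fun hi hj => hs.isClique hi hj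
    have hne : G.Adj i j → i ≠ j := fun h => h.ne
    simp only [hH, removeEdgesWithin, SimpleGraph.sdiff_adj, SimpleGraph.deleteEdges_adj,
      Set.mem_ofPred_eq, Sym2.mem_iff, forall_eq_or_imp, forall_eq]
    tauto
  obtain ⟨B, hB, htr, hx⟩ := H.hasLaplacianCertificate
  rw [SimpleGraph.sum_degree_sub_one_of_isCCyclic hr hp hc, hn] at htr
  have hHx : ∀ x : V → ℝ,
      x ⬝ᵥ (H.lapMatrix ℝ *ᵥ x) ≤ 2 * (x ⬝ᵥ x) + x ⬝ᵥ (B *ᵥ x) := by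
    intro x
    refine (hx x).trans ?_
    gcongr
    refine Finset.sum_le_sum fun v _ => ?_
    rw [← sq]
    split_ifs
    · exact le_rfl
    · exact sq_nonneg _
  have hkV : k ≤ Fintype.card V := hn ▸ hkn
  constructor
  · intro _
    -- The clique Laplacian joins `B` and is paid for by its trace.
    have h1 := sum_eigenvalues_le_of_quadraticForm_le (G.isHermitian_lapMatrix ℝ)
      (hB.add (SimpleGraph.posSemidef_lapMatrix ℝ (G \ H))) (a := 2) (fun x => by
        rw [SimpleGraph.dotProduct_lapMatrix_mulVec_eq_add_sdiff hle, add_mulVec, dotProduct_add]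
        linarith [hHx x]) hkV
    rw [trace_add, SimpleGraph.trace_lapMatrix_of_complete_on hK, hs.card_eq] at h1
    unfold laplacianSum
    linarith
  · intro _
    -- The clique Laplacian is bounded by ωI and joins the scalar part.
    have h1 := sum_eigenvalues_le_of_quadraticForm_le (G.isHermitian_lapMatrix ℝ) hB
      (a := ω + 2) (fun x => by
        have h2 := SimpleGraph.dotProduct_lapMatrix_mulVec_le_of_complete_on hK x
        rw [hs.card_eq] at h2
        rw [SimpleGraph.dotProduct_lapMatrix_mulVec_eq_add_sdiff hle]
        linarith [hHx x]) hkV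
    unfold laplacianSum
    linarith
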